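/- Let $\Gamma=[3,5,3]$ be the Coxeter group $$\Gamma=\langle a,b,c,d \mid a^2=b^2=c^2=d^2=(ab)^3=(bc)^5=(cd)^3=(ac)^2=(ad)^2=(bd)^2=1\rangle,$$ and let $\Delta=[3,5,3]^+$ be its even subgroup, that is, the kernel of the homomorphism $\Gamma\to C_2$ sending each of $a,b,c,d$ to the nontrivial element. For a prime power $q=p^n$ ($p$ prime, $n\ge 1$) let $L_2(q)=SL_2(q)/\{\pm I\}$. There is a unique normal subgroup $K_0$ of $\Delta$ with $\Delta/K_0\cong L_2(11)$; it is normal in $\Gamma$, and $\Gamma/K_0\cong L_2(11)\times C_2$. Let $N_0$ be the subgroup of $\Gamma$ containing $K_0$ such that $N_0/K_0$ is the direct factor $C_2$ of $\Gamma/K_0$ (it does not depend on the chosen isomorphism $\Gamma/K_0\cong L_2(11)\times C_2$). Then the proper normal subgroups $N$ of $\Gamma$ such that $\Gamma/N$ is isomorphic to a subgroup of $L_2(q)$ for some prime power $q$ are exactly $\Delta$ and $N_0$, and $\Gamma/\Delta\cong C_2$, $\Gamma/N_0\cong L_2(11)$. -/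

import Mathlib

/-- The Coxeter matrix of the linear diagram `[3,5,3]`. -/
def coxeterMatrix353 : CoxeterMatrix (Fin 4) where
  M := !![1, 3, 2, 2;
          3, 1, 5, 2;
          2, 5, 1, 3;
          2, 2, 3, 1]
  isSymm := by
    ext i j
    fin_cases i <;> fin_cases j <;> rfl
  diagonal := by
    intro i
    fin_cases i <;> rfl
  off_diagonal := by
    intro i j h
    fin_cases i <;> fin_cases j <;> first | exact absurd rfl h | (intro h'; cases h')

/-- The Coxeter group `Γ = [3,5,3]`, with presentation
`⟨a, b, c, d ∣ a² = b² = c² = d² = (ab)³ = (bc)⁵ = (cd)³ = (ac)² = (ad)² = (bd)² = 1⟩`. -/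
abbrev GammaGroup : Type := coxeterMatrix353.Group

/-- The even subgroup `Δ = [3,5,3]⁺`: the kernel of the homomorphism from `Γ` to the cyclic group
of order two that sends each of the generators `a, b, c, d` to the nontrivial element. -/
abbrev evenSubgroup : Subgroup GammaGroup :=
  coxeterMatrix353.toCoxeterSystem.lengthParity.ker

/-- The group `L₂(F) = SL₂(F) / {±I}` over a field `F`
(the centre of `SL₂(F)` consists of the matrices `±I`). -/
abbrev L2 (F : Type) [Field F] : Type := Matrix.ProjectiveSpecialLinearGroup (Fin 2) F

instance fact_prime_eleven : Fact (Nat.Prime 11) := ⟨by norm_num⟩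

/-- The cyclic group of order two, written multiplicatively. -/
abbrev C2 : Type := Multiplicative (ZMod 2)

/-- `G` is isomorphic to a subgroup of `L₂(q)` for some prime power `q = p ^ n`, `n ≥ 1`. -/
def IsoToSubgroupOfSomeL2 (G : Type) [Group G] : Prop :=
  ∃ (p n : ℕ) (_ : Fact p.Prime), n ≠ 0 ∧
    ∃ H : Subgroup (L2 (GaloisField p n)), Nonempty (G ≃* H)

/-- `K` is a normal subgroup of `Δ` with `Δ / K ≅ L₂(11)`. -/
def HasQuotientL2Eleven (K : Subgroup evenSubgroup) : Prop :=
  ∃ _ : K.Normal, Nonempty (evenSubgroup ⧸ K ≃* L2 (ZMod 11))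

/-- Given an isomorphism `φ : Γ / K ≅ L₂(11) × C₂`, the subgroup `N` of `Γ` containing `K` for
which `N / K` is the direct factor `1 × C₂`. -/
def overgroupOfC2Factor (K : Subgroup GammaGroup) [K.Normal]
    (φ : GammaGroup ⧸ K ≃* L2 (ZMod 11) × C2) : Subgroup GammaGroup :=
  (Subgroup.prod (⊥ : Subgroup (L2 (ZMod 11))) (⊤ : Subgroup C2)).comap
    (φ.toMonoidHom.comp (QuotientGroup.mk' K))

/-! A normal subgroup `N` with `Γ / N` inside some `L₂(q)` is the kernel of a homomorphism `f : Γ →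
L₂(F)`, so the task is to determine all such kernels. If `f` identifies `a` and `b`, the odd labels
3, 5, 3 against the commutations make all four generators equal, and the kernel is `Γ` or `Δ`.

Otherwise no generator and no product of two distinct generators dies, and Cayley–Hamilton fixes the
traces of lifts to `SL₂(F)`: 0 in order 2, ±1 in order 3, a root of `t² = ±t + 1` in order 5. As the
diagram is a path, the lifts can be chosen along it so that `tr AB = tr CD = 1` and `t = tr BC` has
`t² = t + 1`. Four traceless 2 × 2 matrices lie in a space of dimension 3, so their Gram determinant
for the trace form vanishes: `9 = 4t²`. Hence `4t = 5`, then `25 = 36`: the characteristic is 11 and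
`t = 4` (`exists_lifts_of_coxeterRelations`). All remaining traces follow, so `C` and `D` are fixed
integer combinations of `1, A, B, AB`. Since these four matrices are linearly independent and their
multiplication table depends only on traces, any two such `f` have the same kernel
(`ker_eq_ker_of_map_zero_ne_map_one`).

The same method on the rotations `ab, bc, cd` shows that `Δ` has only one kernel of a nontrivial
homomorphism to `L₂(11)` (`ker_eq_ker_of_ker_ne_top`). Existence comes from explicit matrices over
the field of order 11, which with the parity map `Γ` onto `L₂(11) × C₂`. The factor `C₂` is the
centre of that product, so `N₀` is independent of the isomorphism. -/

open Matrix

/-- The projection from `SL₂` to `L₂`. -/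
def toL2 (F : Type) [Field F] : SpecialLinearGroup (Fin 2) F →* L2 F :=
  QuotientGroup.mk' _

/-! ### Traces of lifts of elements of order 2, 3 and 5 -/

section Projection

variable {F : Type} [Field F]

theorem toL2_surjective : Function.Surjective (toL2 F) := QuotientGroup.mk'_surjective _

theorem toL2_eq_one_iff (M : SpecialLinearGroup (Fin 2) F) :
    toL2 F M = 1 ↔ ∃ r : F, (M : Matrix (Fin 2) (Fin 2) F) = r • 1 := by
  rw [toL2, ← MonoidHom.mem_ker, QuotientGroup.ker_mk', Matrix.SpecialLinearGroup.mem_center_iff]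
  constructor
  · rintro ⟨r, -, h⟩
    exact ⟨r, by rw [← h, scalar_apply, smul_one_eq_diagonal]⟩
  · rintro ⟨r, h⟩
    refine ⟨r, ?_, by rw [h, scalar_apply, smul_one_eq_diagonal]⟩
    have := M.det_coe
    rw [h] at this
    simpa using this

theorem toL2_neg (M : SpecialLinearGroup (Fin 2) F) : toL2 F (-M) = toL2 F M := by
  have h : toL2 F (-1) = 1 := (toL2_eq_one_iff _).2 ⟨-1, by simp⟩
  rw [← neg_one_mul, map_mul, h, one_mul]

theorem toL2_eq_one_iff_eq_or_eq_neg (M : SpecialLinearGroup (Fin 2) F) :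
    toL2 F M = 1 ↔ M = 1 ∨ M = -1 := by
  constructor
  · intro h
    obtain ⟨r, hr⟩ := (toL2_eq_one_iff M).1 h
    have h1 := M.det_coe
    rw [hr] at h1
    have h2 : r ^ 2 = 1 := by simpa using h1
    rcases sq_eq_one_iff.1 h2 with rfl | rfl
    · left; ext1; simp [hr]
    · right; ext1; simp [hr]
  · rintro (rfl | rfl)
    · exact map_one _
    · rw [toL2_neg, map_one]

theorem toL2_eq_iff (M N : SpecialLinearGroup (Fin 2) F) :
    toL2 F M = toL2 F N ↔ M = N ∨ M = -N := by
  rw [← mul_inv_eq_one, ← map_inv, ← map_mul, toL2_eq_one_iff_eq_or_eq_neg, mul_inv_eq_one,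
    mul_inv_eq_iff_eq_mul, neg_one_mul]

/-- By Cayley–Hamilton each power of `M` is a combination of `M` and `1`. When that power is scalar,
this lemma makes the coefficient of `M`, a polynomial in the trace, vanish. -/
theorem eq_zero_of_smul_eq_smul_one {M : SpecialLinearGroup (Fin 2) F} (hM : toL2 F M ≠ 1)
    {c r : F} (h : c • (M : Matrix (Fin 2) (Fin 2) F) = r • 1) : c = 0 := by
  by_contra hc
  refine hM ((toL2_eq_one_iff M).2 ⟨c⁻¹ * r, ?_⟩)
  rw [mul_smul, ← h, inv_smul_smul₀ hc]

theorem sq_eq_trace_smul_sub_one (M : SpecialLinearGroup (Fin 2) F) :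
    (M : Matrix (Fin 2) (Fin 2) F) * M = (M : Matrix (Fin 2) (Fin 2) F).trace • M.1 - 1 := by
  have h := M.det_coe
  rw [det_fin_two] at h
  ext i j
  fin_cases i <;> fin_cases j <;> simp [mul_apply, Fin.sum_univ_two, trace_fin_two] <;>
    first | linear_combination -h | ring

theorem trace_eq_zero_of_toL2_sq {M : SpecialLinearGroup (Fin 2) F} (h1 : toL2 F M ≠ 1)
    (h2 : toL2 F M ^ 2 = 1) : (M : Matrix (Fin 2) (Fin 2) F).trace = 0 := by
  rw [← map_pow, toL2_eq_one_iff] at h2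
  obtain ⟨r, hr⟩ := h2
  refine eq_zero_of_smul_eq_smul_one (r := r + 1) h1 ?_
  rw [Matrix.SpecialLinearGroup.coe_pow, pow_two, sq_eq_trace_smul_sub_one] at hr
  rw [add_smul, ← hr]
  simp

theorem trace_of_toL2_pow_three {M : SpecialLinearGroup (Fin 2) F} (h1 : toL2 F M ≠ 1)
    (h3 : toL2 F M ^ 3 = 1) :
    (M : Matrix (Fin 2) (Fin 2) F).trace = 1 ∨ (M : Matrix (Fin 2) (Fin 2) F).trace = -1 := by
  rw [← map_pow, toL2_eq_one_iff] at h3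
  obtain ⟨r, hr⟩ := h3
  have hs := sq_eq_trace_smul_sub_one M
  set t := (M : Matrix (Fin 2) (Fin 2) F).trace
  have : t ^ 2 - 1 = 0 := by
    refine eq_zero_of_smul_eq_smul_one (r := r + t) h1 ?_
    have h : (M : Matrix (Fin 2) (Fin 2) F) ^ 3 = (t ^ 2 - 1) • M.1 - t • 1 := by
      rw [pow_succ, pow_two, hs, sub_mul, smul_mul_assoc, hs, one_mul]
      module
    rw [Matrix.SpecialLinearGroup.coe_pow, h] at hr
    rw [add_smul, ← hr]
    abel
  exact sq_eq_one_iff.1 (sub_eq_zero.1 this)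

theorem trace_of_toL2_pow_five {M : SpecialLinearGroup (Fin 2) F} (h1 : toL2 F M ≠ 1)
    (h5 : toL2 F M ^ 5 = 1) :
    (M : Matrix (Fin 2) (Fin 2) F).trace ^ 2 = (M : Matrix (Fin 2) (Fin 2) F).trace + 1 ∨
    (M : Matrix (Fin 2) (Fin 2) F).trace ^ 2 = -(M : Matrix (Fin 2) (Fin 2) F).trace + 1 := by
  rw [← map_pow, toL2_eq_one_iff] at h5
  obtain ⟨r, hr⟩ := h5
  have hs := sq_eq_trace_smul_sub_one M
  set t := (M : Matrix (Fin 2) (Fin 2) F).trace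
  have : (t ^ 2 - t - 1) * (t ^ 2 + t - 1) = 0 := by
    refine eq_zero_of_smul_eq_smul_one (r := r + (t ^ 3 - 2 * t)) h1 ?_
    have h : (M : Matrix (Fin 2) (Fin 2) F) ^ 5 =
        ((t ^ 2 - t - 1) * (t ^ 2 + t - 1)) • M.1 - (t ^ 3 - 2 * t) • 1 := by
      have h3 : (M : Matrix (Fin 2) (Fin 2) F) ^ 3 = (t ^ 2 - 1) • M.1 - t • 1 := by
        rw [pow_succ, pow_two, hs, sub_mul, smul_mul_assoc, hs, one_mul]
        module
      rw [show 5 = 3 + 1 + 1 from rfl, pow_succ, pow_succ, h3, sub_mul, sub_mul, smul_mul_assoc,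
        smul_mul_assoc, hs, smul_mul_assoc, smul_mul_assoc, one_mul, sub_mul, smul_mul_assoc, hs,
        one_mul]
      module
    rw [Matrix.SpecialLinearGroup.coe_pow, h] at hr
    rw [add_smul, ← hr]
    abel
  rcases mul_eq_zero.1 this with h | h
  · left; linear_combination h
  · right; linear_combination h

end Projection

/-! ### Trace form identities for 2 × 2 matrices -/

section Expansion

variable {R : Type} [CommRing R]

/-- Cramer's rule for the trace form on `1, X, Y, XY`: the pairings of `V` with these four matrices
determine `V` once the discriminant on the left is invertible. -/
theorem expansion_in_pair (X Y V : Matrix (Fin 2) (Fin 2) R) (hX : X.det = 1) (hY : Y.det = 1)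
    {x y z t₀ t₁ t₂ t₃ : R} (hx : X.trace = x) (hy : Y.trace = y) (hz : (X * Y).trace = z)
    (h₀ : V.trace = t₀) (h₁ : (X * V).trace = t₁) (h₂ : (Y * V).trace = t₂)
    (h₃ : (X * Y * V).trace = t₃) :
    (x ^ 2 + y ^ 2 + z ^ 2 - x * y * z - 4) • V =
      ((x ^ 2 + y ^ 2 + z ^ 2 - x * y * z - 2) * t₀ - x * t₁ - y * t₂ + (x * y - z) * t₃) • 1 +
      (-x * t₀ + 2 * t₁ + z * t₂ - y * t₃) • X +
      (-y * t₀ + z * t₁ + 2 * t₂ - x * t₃) • Y +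
      ((x * y - z) * t₀ - y * t₁ - x * t₂ + 2 * t₃) • (X * Y) := by
  -- With the determinants restored, this is a polynomial identity in the entries, free of
  -- hypotheses.
  have key : (Y.det * x ^ 2 + X.det * y ^ 2 + z ^ 2 - x * y * z - 4 * X.det * Y.det) • V =
      ((Y.det * x ^ 2 + X.det * y ^ 2 + z ^ 2 - x * y * z - 2 * X.det * Y.det) * t₀ -
        Y.det * x * t₁ - X.det * y * t₂ + (x * y - z) * t₃) • 1 +
      (-Y.det * x * t₀ + 2 * Y.det * t₁ + z * t₂ - y * t₃) • X +
      (-X.det * y * t₀ + z * t₁ + 2 * X.det * t₂ - x * t₃) • Y +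
      ((x * y - z) * t₀ - y * t₁ - x * t₂ + 2 * t₃) • (X * Y) := by
    clear hX hY
    subst hx hy hz h₀ h₁ h₂ h₃
    ext i j
    fin_cases i <;> fin_cases j <;>
      simp [mul_apply, Fin.sum_univ_two, trace_fin_two, det_fin_two] <;> ring
  simpa [hX, hY] using key

theorem coeff_eq_zero_of_pair (X Y : Matrix (Fin 2) (Fin 2) R) (hX : X.det = 1) (hY : Y.det = 1)
    {x y z : R} (hx : X.trace = x) (hy : Y.trace = y) (hz : (X * Y).trace = z)
    {c₀ c₁ c₂ c₃ : R}
    (h : c₀ • (1 : Matrix (Fin 2) (Fin 2) R) + c₁ • X + c₂ • Y + c₃ • (X * Y) = 0) :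
    (x ^ 2 + y ^ 2 + z ^ 2 - x * y * z - 4) * c₁ = 0 ∧
    (x ^ 2 + y ^ 2 + z ^ 2 - x * y * z - 4) * c₂ = 0 ∧
    (x ^ 2 + y ^ 2 + z ^ 2 - x * y * z - 4) * c₃ = 0 := by
  have aux (V : Matrix (Fin 2) (Fin 2) R)
      (hV : V = c₀ • (1 : Matrix (Fin 2) (Fin 2) R) + c₁ • X + c₂ • Y + c₃ • (X * Y)) :
      (Y.det * x ^ 2 + X.det * y ^ 2 + z ^ 2 - x * y * z - 4 * X.det * Y.det) * c₁ =
        -Y.det * x * V.trace + 2 * Y.det * (X * V).trace + z * (Y * V).trace -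
          y * (X * Y * V).trace ∧
      (Y.det * x ^ 2 + X.det * y ^ 2 + z ^ 2 - x * y * z - 4 * X.det * Y.det) * c₂ =
        -X.det * y * V.trace + z * (X * V).trace + 2 * X.det * (Y * V).trace -
          x * (X * Y * V).trace ∧
      (Y.det * x ^ 2 + X.det * y ^ 2 + z ^ 2 - x * y * z - 4 * X.det * Y.det) * c₃ =
        (x * y - z) * V.trace - y * (X * V).trace - x * (Y * V).trace + 2 * (X * Y * V).trace := by
    clear hX hY
    subst hx hy hz hV
    simp only [mul_apply, Fin.sum_univ_two, trace_fin_two, det_fin_two, Matrix.add_apply, Matrix.smul_apply,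
      smul_eq_mul, one_apply_eq, ne_eq, zero_ne_one, one_ne_zero, not_false_eq_true, one_apply_ne]
    refine ⟨?_, ?_, ?_⟩ <;> ring
  simpa [hX, hY] using aux 0 h.symm

/-- Traceless matrices have three free entries, so the Gram determinant of four of them is zero. The
three vanishing pairings make the Gram matrix tridiagonal, and this is its expanded determinant. -/
theorem gram_of_trace_eq_zero {A B C D : Matrix (Fin 2) (Fin 2) R} (hA : A.trace = 0)
    (hB : B.trace = 0) (hC : C.trace = 0) (hD : D.trace = 0) (hAC : (A * C).trace = 0)
    (hAD : (A * D).trace = 0) (hBD : (B * D).trace = 0) :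
    ((A * A).trace * (B * B).trace - (A * B).trace ^ 2) *
      ((C * C).trace * (D * D).trace - (C * D).trace ^ 2) =
    (A * A).trace * (D * D).trace * (B * C).trace ^ 2 := by
  have key : Matrix.det
      !![(A * A).trace, (A * B).trace, (A * C).trace, (A * D).trace;
         (A * B).trace, (B * B).trace, (B * C).trace, (B * D).trace;
         (A * C).trace, (B * C).trace, (C * C).trace, (C * D).trace;
         (A * D).trace, (B * D).trace, (C * D).trace, (D * D).trace] = 0 := by
    rw [trace_fin_two] at hA hB hC hD
    have factor (X Y : Matrix (Fin 2) (Fin 2) R) (hX : X 0 0 + X 1 1 = 0)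
        (hY : Y 0 0 + Y 1 1 = 0) :
        (X * Y).trace = 2 * (X 0 0 * Y 0 0) + X 0 1 * Y 1 0 + X 1 0 * Y 0 1 := by
      rw [trace_fin_two, mul_apply, mul_apply, Fin.sum_univ_two, Fin.sum_univ_two]
      linear_combination Y 1 1 * hX - X 0 0 * hY
    rw [factor A A hA hA, factor A B hA hB, factor A C hA hC, factor A D hA hD, factor B B hB hB,
      factor B C hB hC, factor B D hB hD, factor C C hC hC, factor C D hC hD, factor D D hD hD]
    -- The Gram matrix factors through rank 3, padded with a zero column and a zero row.
    have : !![A 0 0, A 0 1, A 1 0, 0; B 0 0, B 0 1, B 1 0, 0; C 0 0, C 0 1, C 1 0, 0;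
          D 0 0, D 0 1, D 1 0, 0] *
        !![2 * A 0 0, 2 * B 0 0, 2 * C 0 0, 2 * D 0 0; A 1 0, B 1 0, C 1 0, D 1 0;
          A 0 1, B 0 1, C 0 1, D 0 1; 0, 0, 0, 0] =
        !![2 * (A 0 0 * A 0 0) + A 0 1 * A 1 0 + A 1 0 * A 0 1,
           2 * (A 0 0 * B 0 0) + A 0 1 * B 1 0 + A 1 0 * B 0 1,
           2 * (A 0 0 * C 0 0) + A 0 1 * C 1 0 + A 1 0 * C 0 1,
           2 * (A 0 0 * D 0 0) + A 0 1 * D 1 0 + A 1 0 * D 0 1;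
           2 * (A 0 0 * B 0 0) + A 0 1 * B 1 0 + A 1 0 * B 0 1,
           2 * (B 0 0 * B 0 0) + B 0 1 * B 1 0 + B 1 0 * B 0 1,
           2 * (B 0 0 * C 0 0) + B 0 1 * C 1 0 + B 1 0 * C 0 1,
           2 * (B 0 0 * D 0 0) + B 0 1 * D 1 0 + B 1 0 * D 0 1;
           2 * (A 0 0 * C 0 0) + A 0 1 * C 1 0 + A 1 0 * C 0 1,
           2 * (B 0 0 * C 0 0) + B 0 1 * C 1 0 + B 1 0 * C 0 1,
           2 * (C 0 0 * C 0 0) + C 0 1 * C 1 0 + C 1 0 * C 0 1,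
           2 * (C 0 0 * D 0 0) + C 0 1 * D 1 0 + C 1 0 * D 0 1;
           2 * (A 0 0 * D 0 0) + A 0 1 * D 1 0 + A 1 0 * D 0 1,
           2 * (B 0 0 * D 0 0) + B 0 1 * D 1 0 + B 1 0 * D 0 1,
           2 * (C 0 0 * D 0 0) + C 0 1 * D 1 0 + C 1 0 * D 0 1,
           2 * (D 0 0 * D 0 0) + D 0 1 * D 1 0 + D 1 0 * D 0 1] := by
      ext i j
      fin_cases i <;> fin_cases j <;>
        simp [mul_apply, Fin.sum_univ_four] <;> ring
    rw [← this, det_mul]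
    rw [det_eq_zero_of_column_eq_zero (j := 3), zero_mul]
    intro i
    fin_cases i <;> rfl
  rw [hAC, hAD, hBD] at key
  simp [det_succ_row_zero, Fin.sum_univ_succ, Fin.succAbove] at key
  linear_combination key

end Expansion

/-! ### The algebra spanned by `1, X, Y, XY` -/

section Pair

variable {F : Type} [Field F]

/-- The combination `v₀ + v₁ X + v₂ Y + v₃ X Y` with integer coefficients. -/
def pairComb (X Y : Matrix (Fin 2) (Fin 2) F) (v : Fin 4 → ℤ) : Matrix (Fin 2) (Fin 2) F :=
  (v 0 : F) • 1 + (v 1 : F) • X + (v 2 : F) • Y + (v 3 : F) • (X * Y)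

/-- `X` and `Y` have determinant one, and `X`, `Y`, `X Y` have traces the integers `x`, `y`, `z`. -/
structure IsTracePair (X Y : Matrix (Fin 2) (Fin 2) F) (x y z : ℤ) : Prop where
  det_left : X.det = 1
  det_right : Y.det = 1
  trace_left : X.trace = x
  trace_right : Y.trace = y
  trace_mul : (X * Y).trace = z

/-- The coefficients of the product of two combinations of a pair of matrices of determinant one
with traces `x`, `y` and `z`. -/
def pairMul (x y z : ℤ) (v w : Fin 4 → ℤ) : Fin 4 → ℤ :=
  ![v 0 * w 0 - v 1 * w 1 + (z - x * y) * v 2 * w 1 - v 2 * w 2 - x * v 2 * w 3 - y * v 3 * w 1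
      - v 3 * w 3,
    v 0 * w 1 + v 1 * w 0 + x * v 1 * w 1 + y * v 2 * w 1 + v 2 * w 3 + z * v 3 * w 1 - v 3 * w 2,
    v 0 * w 2 + v 2 * w 0 - v 1 * w 3 + x * v 2 * w 1 + y * v 2 * w 2 + z * v 2 * w 3 + v 3 * w 1,
    v 0 * w 3 + v 3 * w 0 + v 1 * w 2 + x * v 1 * w 3 - v 2 * w 1 + y * v 3 * w 2 + z * v 3 * w 3]

/-- The trace of a combination of a pair of matrices with traces `x`, `y` and `z`. -/
def pairTrace (x y z : ℤ) (v : Fin 4 → ℤ) : ℤ := 2 * v 0 + x * v 1 + y * v 2 + z * v 3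

theorem mul_self_of_det_eq_one {X : Matrix (Fin 2) (Fin 2) F} (h : X.det = 1) :
    X * X = X.trace • X - 1 :=
  sq_eq_trace_smul_sub_one ⟨X, h⟩

/-- Polarised Cayley–Hamilton. -/
theorem mul_swap_of_trace (X Y : Matrix (Fin 2) (Fin 2) F) :
    Y * X = ((X * Y).trace - X.trace * Y.trace) • 1 + Y.trace • X + X.trace • Y - X * Y := by
  ext i j
  fin_cases i <;> fin_cases j <;>
    simp [mul_apply, Fin.sum_univ_two, trace_fin_two] <;> ring

variable {X Y : Matrix (Fin 2) (Fin 2) F} {x y z : ℤ}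

theorem IsTracePair.pairComb_mul (h : IsTracePair X Y x y z) (v w : Fin 4 → ℤ) :
    pairComb X Y v * pairComb X Y w = pairComb X Y (pairMul x y z v w) := by
  have hXX := mul_self_of_det_eq_one h.det_left
  have hYY := mul_self_of_det_eq_one h.det_right
  have hYX := mul_swap_of_trace X Y
  rw [h.trace_left] at hXX
  rw [h.trace_right] at hYY
  rw [h.trace_left, h.trace_right, h.trace_mul] at hYX
  have hXXY : X * (X * Y) = (x : F) • (X * Y) - Y := by
    rw [← mul_assoc, hXX, sub_mul, smul_mul_assoc, one_mul]
  have hXYY : X * Y * Y = (y : F) • (X * Y) - X := by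
    rw [mul_assoc, hYY, mul_sub, mul_smul_comm, mul_one]
  have hYXY : Y * (X * Y) = X + (z : F) • Y - (x : F) • 1 := by
    rw [← mul_assoc, hYX]
    simp only [add_mul, sub_mul, smul_mul_assoc, one_mul, hYY, hXYY]
    module
  have hXYX : X * Y * X = Y + (z : F) • X - (y : F) • 1 := by
    rw [mul_assoc, hYX]
    simp only [mul_add, mul_sub, mul_smul_comm, mul_one, hXX, hXXY]
    module
  have hXYXY : X * Y * (X * Y) = (z : F) • (X * Y) - 1 := by
    rw [mul_self_of_det_eq_one (by rw [det_mul, h.det_left, h.det_right, one_mul]), h.trace_mul]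
  simp only [pairComb, add_mul, mul_add, smul_mul_smul_comm, one_mul, mul_one, hXX, hYY, hYX, hXXY,
    hXYY, hYXY, hXYX, hXYXY, pairMul, cons_val]
  push_cast
  module

theorem IsTracePair.trace_pairComb (h : IsTracePair X Y x y z) (v : Fin 4 → ℤ) :
    (pairComb X Y v).trace = (pairTrace x y z v : ℤ) := by
  simp only [pairComb, trace_add, trace_smul, h.trace_left, h.trace_right, h.trace_mul, pairTrace,
    trace_one, Fintype.card_fin, smul_eq_mul]
  push_cast
  ring

theorem pairComb_sub (X Y : Matrix (Fin 2) (Fin 2) F) (c : ℤ) (v : Fin 4 → ℤ) :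
    (c : F) • 1 - pairComb X Y v = pairComb X Y ![c - v 0, -v 1, -v 2, -v 3] := by
  simp only [pairComb, cons_val]
  push_cast
  module

theorem coe_inv_eq (M : Matrix.SpecialLinearGroup (Fin 2) F) :
    ((M⁻¹ : Matrix.SpecialLinearGroup (Fin 2) F) : Matrix (Fin 2) (Fin 2) F) =
      (M : Matrix (Fin 2) (Fin 2) F).trace • 1 - M.1 := by
  rw [Matrix.SpecialLinearGroup.coe_inv, adjugate_fin_two]
  ext i j
  fin_cases i <;> fin_cases j <;> simp [trace_fin_two]

theorem IsTracePair.pairComb_scalar_iff (p : ℕ) [Fact p.Prime] [CharP F p]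
    (h : IsTracePair X Y x y z)
    (hp : ¬ (p : ℤ) ∣ x ^ 2 + y ^ 2 + z ^ 2 - x * y * z - 4) (v : Fin 4 → ℤ) :
    (∃ r : F, pairComb X Y v = r • 1) ↔ (p : ℤ) ∣ v 1 ∧ (p : ℤ) ∣ v 2 ∧ (p : ℤ) ∣ v 3 := by
  simp only [← CharP.intCast_eq_zero_iff F p] at hp ⊢
  push_cast at hp
  constructor
  · rintro ⟨r, hr⟩
    have := coeff_eq_zero_of_pair X Y h.det_left h.det_right h.trace_left h.trace_right h.trace_mul
      (c₀ := v 0 - r) (c₁ := v 1) (c₂ := v 2) (c₃ := v 3) (by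
        rw [← sub_eq_zero.2 hr, pairComb]
        module)
    simpa [hp] using this
  · rintro ⟨h1, h2, h3⟩
    exact ⟨v 0, by simp [pairComb, h1, h2, h3]⟩

end Pair

/-! ### Comparing kernels through coefficients -/

section Comparison

variable {G F L : Type} [Group G] [Field F] [Field L] {x y z : ℤ}
  {X Y : Matrix (Fin 2) (Fin 2) F} {X' Y' : Matrix (Fin 2) (Fin 2) L}

/-- Two homomorphisms to `L₂` have lifts at `g` with the same coefficients in terms of `X`, `Y` and
of `X'`, `Y'`. -/
def SameCoeffs (f : G →* L2 F) (f' : G →* L2 L) (X Y : Matrix (Fin 2) (Fin 2) F)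
    (X' Y' : Matrix (Fin 2) (Fin 2) L) (g : G) (v : Fin 4 → ℤ) : Prop :=
  (∃ M : Matrix.SpecialLinearGroup (Fin 2) F, toL2 F M = f g ∧ M.1 = pairComb X Y v) ∧
  ∃ M : Matrix.SpecialLinearGroup (Fin 2) L, toL2 L M = f' g ∧ M.1 = pairComb X' Y' v

/-- The subgroup of all elements where two homomorphisms to `L₂` have lifts with the same
coefficients. -/
def sameCoeffsSubgroup (f : G →* L2 F) (f' : G →* L2 L) (h : IsTracePair X Y x y z)
    (h' : IsTracePair X' Y' x y z) : Subgroup G where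
  carrier := {g | ∃ v, SameCoeffs f f' X Y X' Y' g v}
  one_mem' := ⟨![1, 0, 0, 0], ⟨1, by simp, by simp [pairComb]⟩, ⟨1, by simp, by simp [pairComb]⟩⟩
  mul_mem' := by
    rintro a b ⟨v, ⟨M, hM, hMv⟩, M', hM', hMv'⟩ ⟨w, ⟨N, hN, hNw⟩, N', hN', hNw'⟩
    refine ⟨pairMul x y z v w, ⟨M * N, by rw [map_mul, map_mul, hM, hN], ?_⟩,
      M' * N', by rw [map_mul, map_mul, hM', hN'], ?_⟩
    · rw [← h.pairComb_mul, ← hMv, ← hNw]; rfl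
    · rw [← h'.pairComb_mul, ← hMv', ← hNw']; rfl
  inv_mem' := by
    rintro a ⟨v, ⟨M, hM, hMv⟩, M', hM', hMv'⟩
    refine ⟨![pairTrace x y z v - v 0, -v 1, -v 2, -v 3], ⟨M⁻¹, by rw [map_inv, map_inv, hM], ?_⟩,
      M'⁻¹, by rw [map_inv, map_inv, hM'], ?_⟩
    · rw [coe_inv_eq, hMv, h.trace_pairComb, pairComb_sub]
    · rw [coe_inv_eq, hMv', h'.trace_pairComb, pairComb_sub]

theorem mem_sameCoeffsSubgroup {f : G →* L2 F} {f' : G →* L2 L} {h : IsTracePair X Y x y z}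
    {h' : IsTracePair X' Y' x y z} {g : G} :
    g ∈ sameCoeffsSubgroup f f' h h' ↔ ∃ v, SameCoeffs f f' X Y X' Y' g v := Iff.rfl

/-- With nonzero discriminant, a lift is scalar exactly when `p` divides its last three
coefficients, a condition on `v` alone. This replaces conjugating one representation into the other,
and allows different fields. -/
theorem ker_eq_of_sameCoeffsSubgroup_eq_top (p : ℕ) [Fact p.Prime] [CharP F p] [CharP L p]
    {f : G →* L2 F} {f' : G →* L2 L} {h : IsTracePair X Y x y z} {h' : IsTracePair X' Y' x y z}
    (hp : ¬ (p : ℤ) ∣ x ^ 2 + y ^ 2 + z ^ 2 - x * y * z - 4)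
    (htop : sameCoeffsSubgroup f f' h h' = ⊤) : f.ker = f'.ker := by
  ext g
  have hg : g ∈ sameCoeffsSubgroup f f' h h' := htop ▸ Subgroup.mem_top g
  obtain ⟨v, ⟨M, hM, hMv⟩, M', hM', hMv'⟩ := hg
  rw [MonoidHom.mem_ker, MonoidHom.mem_ker, ← hM, ← hM', toL2_eq_one_iff, toL2_eq_one_iff, hMv,
    hMv', h.pairComb_scalar_iff p hp, h'.pairComb_scalar_iff p hp]

end Comparison

/-! ### Nondegeneracy from the Coxeter and rotation relations -/

section Relations

variable {G : Type*} [Group G]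

theorem eq_one_of_pow_two_of_pow_three {g : G} (h2 : g ^ 2 = 1) (h3 : g ^ 3 = 1) : g = 1 := by
  rwa [pow_succ, h2, one_mul] at h3

theorem eq_one_of_pow_two_of_pow_five {g : G} (h2 : g ^ 2 = 1) (h5 : g ^ 5 = 1) : g = 1 := by
  rwa [show 5 = 2 * 2 + 1 from rfl, pow_succ, pow_mul, h2, one_pow, one_mul] at h5

theorem eq_one_of_pow_three_of_pow_five {g : G} (h3 : g ^ 3 = 1) (h5 : g ^ 5 = 1) : g = 1 := by
  refine eq_one_of_pow_two_of_pow_three ?_ h3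
  rwa [show 5 = 3 + 2 from rfl, pow_add, h3, one_mul] at h5

/-- The defining relations of the Coxeter group `[3,5,3]`. -/
structure CoxeterRelations (a b c d : G) : Prop where
  a_sq : a ^ 2 = 1
  b_sq : b ^ 2 = 1
  c_sq : c ^ 2 = 1
  d_sq : d ^ 2 = 1
  ab : (a * b) ^ 3 = 1
  bc : (b * c) ^ 5 = 1
  cd : (c * d) ^ 3 = 1
  ac : (a * c) ^ 2 = 1
  ad : (a * d) ^ 2 = 1
  bd : (b * d) ^ 2 = 1

variable {a b c d : G}

theorem mul_pow_comm_eq_one {n : ℕ} (h : (a * b) ^ n = 1) : (b * a) ^ n = 1 := by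
  rw [← mul_right_inj a, ← mul_pow_mul, h, one_mul, mul_one]

theorem eq_of_mul_eq_one_of_sq (hb : b ^ 2 = 1) (h : a * b = 1) : a = b := by
  rw [eq_inv_of_mul_eq_one_left h, inv_eq_iff_mul_eq_one, ← pow_two, hb]

namespace CoxeterRelations

theorem a_ne_one (h : CoxeterRelations a b c d) (hab : a ≠ b) : a ≠ 1 := by
  rintro rfl
  exact hab (eq_one_of_pow_two_of_pow_three h.b_sq (by simpa using h.ab)).symm

theorem b_ne_one (h : CoxeterRelations a b c d) (hab : a ≠ b) : b ≠ 1 := by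
  rintro rfl
  exact hab (eq_one_of_pow_two_of_pow_three h.a_sq (by simpa using h.ab))

theorem c_ne_one (h : CoxeterRelations a b c d) (hab : a ≠ b) : c ≠ 1 := by
  rintro rfl
  exact h.b_ne_one hab (eq_one_of_pow_two_of_pow_five h.b_sq (by simpa using h.bc))

theorem d_ne_one (h : CoxeterRelations a b c d) (hab : a ≠ b) : d ≠ 1 := by
  rintro rfl
  exact h.c_ne_one hab (eq_one_of_pow_two_of_pow_three h.c_sq (by simpa using h.cd))

theorem ab_ne_one (h : CoxeterRelations a b c d) (hab : a ≠ b) : a * b ≠ 1 := fun h1 ↦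
  hab (eq_of_mul_eq_one_of_sq h.b_sq h1)

theorem bc_ne_one (h : CoxeterRelations a b c d) (hab : a ≠ b) : b * c ≠ 1 := by
  intro h1
  obtain rfl := eq_of_mul_eq_one_of_sq h.c_sq h1
  exact h.ab_ne_one hab (eq_one_of_pow_two_of_pow_three h.ac h.ab)

theorem ac_ne_one (h : CoxeterRelations a b c d) (hab : a ≠ b) : a * c ≠ 1 := by
  intro h1
  obtain rfl := eq_of_mul_eq_one_of_sq h.c_sq h1
  exact h.ab_ne_one hab (eq_one_of_pow_three_of_pow_five h.ab (mul_pow_comm_eq_one h.bc))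

theorem cd_ne_one (h : CoxeterRelations a b c d) (hab : a ≠ b) : c * d ≠ 1 := by
  intro h1
  obtain rfl := eq_of_mul_eq_one_of_sq h.d_sq h1
  exact h.bc_ne_one hab (eq_one_of_pow_two_of_pow_five h.bd h.bc)

theorem ad_ne_one (h : CoxeterRelations a b c d) (hab : a ≠ b) : a * d ≠ 1 := by
  intro h1
  obtain rfl := eq_of_mul_eq_one_of_sq h.d_sq h1
  exact h.ab_ne_one hab (eq_one_of_pow_two_of_pow_three (mul_pow_comm_eq_one h.bd) h.ab)

theorem bd_ne_one (h : CoxeterRelations a b c d) (hab : a ≠ b) : b * d ≠ 1 := by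
  intro h1
  obtain rfl := eq_of_mul_eq_one_of_sq h.d_sq h1
  exact h.bc_ne_one hab (eq_one_of_pow_three_of_pow_five (mul_pow_comm_eq_one h.cd) h.bc)

/-- The order of `ac = bc` divides 2 and 5; then that of `ad = cd` divides 2 and 3. -/
theorem all_eq (h : CoxeterRelations a b c d) (hab : a = b) : c = a ∧ d = a := by
  subst hab
  have hc : a = c := eq_of_mul_eq_one_of_sq h.c_sq (eq_one_of_pow_two_of_pow_five h.ac h.bc)
  subst hc
  exact ⟨rfl, (eq_of_mul_eq_one_of_sq h.d_sq (eq_one_of_pow_two_of_pow_three h.ad h.cd)).symm⟩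

end CoxeterRelations

/-- The defining relations of the even subgroup of the Coxeter group `[3,5,3]`, for the rotations
`x = ab`, `y = bc`, `z = cd`. -/
structure RotationRelations (x y z : G) : Prop where
  x_pow : x ^ 3 = 1
  y_pow : y ^ 5 = 1
  z_pow : z ^ 3 = 1
  xy_sq : (x * y) ^ 2 = 1
  yz_sq : (y * z) ^ 2 = 1
  xyz_sq : (x * (y * z)) ^ 2 = 1

theorem CoxeterRelations.rotations (h : CoxeterRelations a b c d) :
    RotationRelations (a * b) (b * c) (c * d) := by
  have hb : b * b = 1 := by rw [← pow_two, h.b_sq]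
  have hc : c * c = 1 := by rw [← pow_two, h.c_sq]
  have hac : a * b * (b * c) = a * c := by rw [mul_assoc, ← mul_assoc b, hb, one_mul]
  have hbd : b * c * (c * d) = b * d := by rw [mul_assoc, ← mul_assoc c, hc, one_mul]
  have had : a * b * (b * d) = a * d := by rw [mul_assoc, ← mul_assoc b, hb, one_mul]
  exact ⟨h.ab, h.bc, h.cd, by rw [hac, h.ac], by rw [hbd, h.bd], by rw [hbd, had, h.ad]⟩

namespace RotationRelations

variable {x y z : G}

theorem y_ne_one (h : RotationRelations x y z) (hx : x ≠ 1) : y ≠ 1 := by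
  rintro rfl
  exact hx (eq_one_of_pow_two_of_pow_three (by simpa using h.xy_sq) h.x_pow)

theorem z_ne_one (h : RotationRelations x y z) (hx : x ≠ 1) : z ≠ 1 := by
  rintro rfl
  exact h.y_ne_one hx (eq_one_of_pow_two_of_pow_five (by simpa using h.yz_sq) h.y_pow)

theorem xy_ne_one (h : RotationRelations x y z) (hx : x ≠ 1) : x * y ≠ 1 := by
  intro h1
  refine h.y_ne_one hx (eq_one_of_pow_three_of_pow_five ?_ h.y_pow)
  rw [eq_inv_of_mul_eq_one_right h1, inv_pow, h.x_pow, inv_one]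

theorem yz_ne_one (h : RotationRelations x y z) (hx : x ≠ 1) : y * z ≠ 1 := by
  intro h1
  refine h.y_ne_one hx (eq_one_of_pow_three_of_pow_five ?_ h.y_pow)
  rw [eq_inv_of_mul_eq_one_left h1, inv_pow, h.z_pow, inv_one]

theorem xyz_ne_one (h : RotationRelations x y z) (hx : x ≠ 1) : x * (y * z) ≠ 1 := by
  intro h1
  refine hx (eq_one_of_pow_two_of_pow_three ?_ h.x_pow)
  rw [eq_inv_of_mul_eq_one_left h1, inv_pow, h.yz_sq, inv_one]

end RotationRelations

end Relations

/-! ### Normal forms for lifts of the generators -/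

section Lifts

variable {F : Type} [Field F]

/-- The trace is known up to sign, and negating the lift of `g` changes that sign. -/
theorem exists_lift_trace_mul_of_pow_three (A : Matrix.SpecialLinearGroup (Fin 2) F) {g : L2 F}
    (h1 : toL2 F A * g ≠ 1) (h3 : (toL2 F A * g) ^ 3 = 1) :
    ∃ B : Matrix.SpecialLinearGroup (Fin 2) F, toL2 F B = g ∧ (A.1 * B.1).trace = 1 := by
  obtain ⟨B, rfl⟩ := toL2_surjective g
  rw [← map_mul] at h1 h3
  rcases trace_of_toL2_pow_three h1 h3 with h | h
  · exact ⟨B, rfl, h⟩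
  · refine ⟨-B, toL2_neg B, ?_⟩
    rw [Matrix.SpecialLinearGroup.coe_mul] at h
    rw [Matrix.SpecialLinearGroup.coe_neg, mul_neg, trace_neg, h, neg_neg]

theorem exists_lift_trace_mul_of_pow_five (A : Matrix.SpecialLinearGroup (Fin 2) F) {g : L2 F}
    (h1 : toL2 F A * g ≠ 1) (h5 : (toL2 F A * g) ^ 5 = 1) :
    ∃ B : Matrix.SpecialLinearGroup (Fin 2) F, toL2 F B = g ∧
      (A.1 * B.1).trace ^ 2 = (A.1 * B.1).trace + 1 := by
  obtain ⟨B, rfl⟩ := toL2_surjective g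
  rw [← map_mul] at h1 h5
  rcases trace_of_toL2_pow_five h1 h5 with h | h
  · exact ⟨B, rfl, h⟩
  · refine ⟨-B, toL2_neg B, ?_⟩
    rw [Matrix.SpecialLinearGroup.coe_mul] at h
    rw [Matrix.SpecialLinearGroup.coe_neg, mul_neg, trace_neg, neg_sq, h]

theorem trace_mul_eq_zero_of_toL2 {A B : Matrix.SpecialLinearGroup (Fin 2) F}
    (h1 : toL2 F A * toL2 F B ≠ 1) (h2 : (toL2 F A * toL2 F B) ^ 2 = 1) :
    (A.1 * B.1).trace = 0 := by
  rw [← map_mul] at h1 h2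
  exact trace_eq_zero_of_toL2_sq h1 h2

theorem trace_mul_self_of_trace_eq_zero {A : Matrix (Fin 2) (Fin 2) F} (hA : A.det = 1)
    (h : A.trace = 0) : (A * A).trace = -2 := by
  rw [mul_self_of_det_eq_one hA, h, zero_smul, zero_sub, trace_neg, trace_one]
  simp

theorem exists_lifts_of_coxeterRelations {a b c d : L2 F} (h : CoxeterRelations a b c d)
    (hab : a ≠ b) : (11 : F) = 0 ∧ ∃ A B C D : Matrix.SpecialLinearGroup (Fin 2) F,
      toL2 F A = a ∧ toL2 F B = b ∧ toL2 F C = c ∧ toL2 F D = d ∧ IsTracePair A.1 B.1 0 0 1 ∧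
      C.1 = pairComb A.1 B.1 ![1, 6, 1, 9] ∧ D.1 = pairComb A.1 B.1 ![9, 0, 0, 4] := by
  obtain ⟨A, rfl⟩ := toL2_surjective a
  obtain ⟨B, rfl, tAB⟩ := exists_lift_trace_mul_of_pow_three A (h.ab_ne_one hab) h.ab
  obtain ⟨C, rfl, tBC⟩ := exists_lift_trace_mul_of_pow_five B (h.bc_ne_one hab) h.bc
  obtain ⟨D, rfl, tCD⟩ := exists_lift_trace_mul_of_pow_three C (h.cd_ne_one hab) h.cd
  have tA := trace_eq_zero_of_toL2_sq (h.a_ne_one hab) h.a_sq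
  have tB := trace_eq_zero_of_toL2_sq (h.b_ne_one hab) h.b_sq
  have tC := trace_eq_zero_of_toL2_sq (h.c_ne_one hab) h.c_sq
  have tD := trace_eq_zero_of_toL2_sq (h.d_ne_one hab) h.d_sq
  have tAC := trace_mul_eq_zero_of_toL2 (h.ac_ne_one hab) h.ac
  have tAD := trace_mul_eq_zero_of_toL2 (h.ad_ne_one hab) h.ad
  have tBD := trace_mul_eq_zero_of_toL2 (h.bd_ne_one hab) h.bd
  have tAA := trace_mul_self_of_trace_eq_zero A.det_coe tA
  have tBB := trace_mul_self_of_trace_eq_zero B.det_coe tB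
  have tCC := trace_mul_self_of_trace_eq_zero C.det_coe tC
  have tDD := trace_mul_self_of_trace_eq_zero D.det_coe tD
  have gram := gram_of_trace_eq_zero tA tB tC tD tAC tAD tBD
  rw [tAA, tBB, tCC, tDD, tAB, tCD] at gram
  generalize ht : (B.1 * C.1).trace = t at tBC gram
  have h4 : 4 * t = 5 := by linear_combination -gram - 4 * tBC
  have h11 : (11 : F) = 0 := by linear_combination 4 * gram + (4 * t + 5) * h4
  have ht4 : t = 4 := by linear_combination 3 * h4 + (1 - t) * h11
  subst ht4
  refine ⟨h11, ?_⟩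
  have expansions (A B C D : Matrix.SpecialLinearGroup (Fin 2) F) (tA : A.1.trace = 0)
      (tB : B.1.trace = 0) (tC : C.1.trace = 0) (tD : D.1.trace = 0) (tAB : (A.1 * B.1).trace = 1)
      (tBC : (B.1 * C.1).trace = 4) (tCD : (C.1 * D.1).trace = 1) (tAC : (A.1 * C.1).trace = 0)
      (tAD : (A.1 * D.1).trace = 0) (tBD : (B.1 * D.1).trace = 0)
      (ts : (A.1 * B.1 * C.1).trace = 3) :
      IsTracePair A.1 B.1 0 0 1 ∧
      C.1 = pairComb A.1 B.1 ![1, 6, 1, 9] ∧ D.1 = pairComb A.1 B.1 ![9, 0, 0, 4] := by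
    refine ⟨⟨A.det_coe, B.det_coe, by simpa using tA, by simpa using tB, by simpa using tAB⟩, ?_, ?_⟩
    · have eC := expansion_in_pair A.1 B.1 C.1 A.det_coe B.det_coe tA tB tAB tC tAC tBC ts
      ext i j
      have eC := congrFun (congrFun eC i) j
      simp only [pairComb, Matrix.add_apply, Matrix.smul_apply, smul_eq_mul, cons_val] at eC ⊢
      push_cast
      -- The discriminant is -3, with inverse -4 modulo 11.
      linear_combination -4 * eC + (-C.1 i j + (1 : Matrix (Fin 2) (Fin 2) F) i j - 2 * A.1 i j -
        3 * B.1 i j - 3 * (A.1 * B.1) i j) * h11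
    · generalize tr : (A.1 * B.1 * D.1).trace = r
      have eD := expansion_in_pair A.1 B.1 D.1 A.det_coe B.det_coe tA tB tAB tD tAD tBD tr
      -- Pairing the expansion of `D` with `C`, where `tr CD = 1`, gives a linear equation for `r`.
      have hr := congrArg (fun M ↦ (M * C.1).trace) eD
      simp only [add_mul, smul_mul_assoc, one_mul, trace_add, trace_smul, tC, tAC, tBC, ts,
        smul_eq_mul, trace_mul_comm D.1 C.1, tCD] at hr
      have hr5 : r = 5 := by linear_combination -2 * hr + (-1 - r) * h11
      subst hr5
      ext i j
      have eD := congrFun (congrFun eD i) j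
      simp only [pairComb, Matrix.add_apply, Matrix.smul_apply, smul_eq_mul, cons_val] at eD ⊢
      push_cast
      linear_combination -4 * eD + (-D.1 i j + (1 : Matrix (Fin 2) (Fin 2) F) i j
        - 4 * (A.1 * B.1) i j) * h11
  generalize ts : (A.1 * B.1 * C.1).trace = s
  have eC := expansion_in_pair A.1 B.1 C.1 A.det_coe B.det_coe tA tB tAB tC tAC ht ts
  -- Pairing the expansion of `C` with `C` itself gives `s² = 9`.
  have hs := congrArg (fun M ↦ (M * C.1).trace) eC
  simp only [add_mul, smul_mul_assoc, one_mul, trace_add, trace_smul, tC, tAC, ht, ts,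
    smul_eq_mul, tCC] at hs
  have hs9 : (s - 3) * (s + 3) = 0 := by linear_combination -6 * hs + (-s ^ 2 - 15) * h11
  rcases mul_eq_zero.1 hs9 with h3 | h3
  · exact ⟨A, B, C, D, rfl, rfl, rfl, rfl, expansions A B C D tA tB tC tD tAB ht tCD tAC tAD tBD
      (by rw [ts]; linear_combination h3)⟩
  -- Negating all four lifts keeps the traces of pairs and flips that of `ABC`, so `s = -3` reduces
  -- to `s = 3`.
  · refine ⟨-A, -B, -C, -D, toL2_neg A, toL2_neg B, toL2_neg C, toL2_neg D,
      expansions (-A) (-B) (-C) (-D) ?_ ?_ ?_ ?_ ?_ ?_ ?_ ?_ ?_ ?_ ?_⟩ <;>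
    simp only [Matrix.SpecialLinearGroup.coe_neg, neg_mul, mul_neg, neg_neg, trace_neg, neg_eq_zero,
      tA, tB, tC, tD, tAB, ht, tCD, tAC, tAD, tBD, ts]
    linear_combination -h3

theorem exists_lifts_of_rotationRelations {x y z : L2 (ZMod 11)} (h : RotationRelations x y z)
    (hx : x ≠ 1) : ∃ X Y W : Matrix.SpecialLinearGroup (Fin 2) (ZMod 11),
      toL2 _ X = x ∧ toL2 _ Y = y ∧ toL2 _ W = y * z ∧ IsTracePair X.1 Y.1 1 4 0 ∧
      W.1 = pairComb X.1 Y.1 ![1, 1, 2, 0] := by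
  obtain ⟨X, rfl, tX⟩ := exists_lift_trace_mul_of_pow_three 1 (g := x) (by simpa using hx)
    (by simpa using h.x_pow)
  obtain ⟨Y, rfl, tY⟩ := exists_lift_trace_mul_of_pow_five 1 (g := y) (by simpa using h.y_ne_one hx)
    (by simpa using h.y_pow)
  obtain ⟨Z, rfl, tZ⟩ := exists_lift_trace_mul_of_pow_three 1 (g := z)
    (by simpa using h.z_ne_one hx) (by simpa using h.z_pow)
  rw [Matrix.SpecialLinearGroup.coe_one, one_mul] at tX tY tZ
  have tXY := trace_mul_eq_zero_of_toL2 (h.xy_ne_one hx) h.xy_sq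
  have tYZ := trace_mul_eq_zero_of_toL2 (h.yz_ne_one hx) h.yz_sq
  have tXW := trace_mul_eq_zero_of_toL2 (A := X) (B := Y * Z)
    (by rw [map_mul]; exact h.xyz_ne_one hx) (by rw [map_mul]; exact h.xyz_sq)
  rw [← map_mul]
  have tW : (Y * Z).1.trace = 0 := tYZ
  generalize ht : Y.1.trace = t at tY
  -- Cayley–Hamilton: `tr Y²Z = t · tr YZ - tr Z`.
  have tYW : (Y.1 * (Y * Z).1).trace = -1 := by
    rw [Matrix.SpecialLinearGroup.coe_mul, ← mul_assoc, mul_self_of_det_eq_one Y.det_coe, sub_mul,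
      smul_mul_assoc, one_mul, trace_sub, trace_smul, tYZ, tZ, smul_zero, zero_sub]
  generalize Y * Z = W at tXW tW tYW
  have tWW := trace_mul_self_of_trace_eq_zero W.det_coe tW
  generalize ts : (X.1 * Y.1 * W.1).trace = s
  have eW := expansion_in_pair X.1 Y.1 W.1 X.det_coe Y.det_coe tX ht tXY tW tXW tYW ts
  have hs := congrArg (fun M ↦ (M * W.1).trace) eW
  simp only [add_mul, smul_mul_assoc, one_mul, trace_add, trace_smul, tW, tXW, tYW, ts,
    smul_eq_mul, tWW] at hs
  have h11 : (11 : ZMod 11) = 0 := rfl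
  obtain ⟨rfl, rfl⟩ : t = 4 ∧ s = 5 := by
    -- The roots for `t` are 4 and 8. For 8 the quadratic in `s` has discriminant 6, a nonsquare;
    -- for 4 the discriminant is 0 and `s = 5` is a double root.
    have key : ∀ t s : ZMod 11, t ^ 2 = t + 1 → s ^ 2 + s + t ^ 2 - 2 = 0 → t = 4 ∧ s = 5 := by
      decide
    refine key t s tY ?_
    linear_combination -6 * hs + (-s ^ 2 - s - t ^ 2 + 2) * h11
  refine ⟨X, Y, W, rfl, rfl, rfl, ⟨X.det_coe, Y.det_coe, by simpa using tX, by simpa using ht,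
    by simpa using tXY⟩, ?_⟩
  ext i j
  have eW := congrFun (congrFun eW i) j
  simp only [pairComb, Matrix.add_apply, Matrix.smul_apply, smul_eq_mul, cons_val] at eW ⊢
  push_cast
  -- The discriminant is 13, with inverse 6 modulo 11.
  linear_combination 6 * eW + (-7 * W.1 i j + 13 * (1 : Matrix (Fin 2) (Fin 2) (ZMod 11)) i j
    - 11 * X.1 i j - 4 * Y.1 i j + 6 * (X.1 * Y.1) i j) * h11

end Lifts

/-! ### Kernels of homomorphisms from `Γ` to `L₂` -/

section GammaGroup

/-- The Coxeter generators `a, b, c, d` of `Γ`. -/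
def gen (i : Fin 4) : GammaGroup := coxeterMatrix353.toCoxeterSystem.simple i

theorem coxeterRelations_map {G : Type*} [Group G] (f : GammaGroup →* G) :
    CoxeterRelations (f (gen 0)) (f (gen 1)) (f (gen 2)) (f (gen 3)) := by
  have hsq (i : Fin 4) : f (gen i) ^ 2 = 1 := by
    rw [← map_pow, gen, CoxeterSystem.simple_sq, map_one]
  have hpow (i j : Fin 4) : (f (gen i) * f (gen j)) ^ coxeterMatrix353 i j = 1 := by
    rw [← map_mul, ← map_pow, gen, gen, CoxeterSystem.simple_mul_simple_pow, map_one]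
  exact ⟨hsq 0, hsq 1, hsq 2, hsq 3, hpow 0 1, hpow 1 2, hpow 2 3, hpow 0 2, hpow 0 3, hpow 1 3⟩

theorem lengthParity_gen (i : Fin 4) :
    coxeterMatrix353.toCoxeterSystem.lengthParity (gen i) = Multiplicative.ofAdd 1 :=
  CoxeterSystem.lengthParity_simple _ i

theorem eq_top_of_gen_mem {H : Subgroup GammaGroup} (h : ∀ i, gen i ∈ H) : H = ⊤ := by
  rw [eq_top_iff, ← coxeterMatrix353.toCoxeterSystem.subgroup_closure_range_simple,
    Subgroup.closure_le]
  rintro _ ⟨i, rfl⟩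
  exact h i

theorem map_gen_eq_of_map_zero_eq_map_one {G : Type*} [Group G] {f : GammaGroup →* G}
    (h : f (gen 0) = f (gen 1)) (i : Fin 4) : f (gen i) = f (gen 0) := by
  obtain ⟨h2, h3⟩ := (coxeterRelations_map f).all_eq h
  fin_cases i
  exacts [rfl, h.symm, h2, h3]

theorem ker_eq_evenSubgroup {G : Type*} [Group G] {f : GammaGroup →* G}
    (h : f (gen 0) = f (gen 1)) (h1 : f (gen 0) ≠ 1) : f.ker = evenSubgroup := by
  have hsq := (coxeterRelations_map f).a_sq
  -- All generators have the same image, an involution, so `f w` depends only on the parity of `w`.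
  have key (w : GammaGroup) :
      (f w = 1 ∧ coxeterMatrix353.toCoxeterSystem.lengthParity w = 1) ∨
      (f w = f (gen 0) ∧
        coxeterMatrix353.toCoxeterSystem.lengthParity w = Multiplicative.ofAdd 1) := by
    induction w using coxeterMatrix353.toCoxeterSystem.simple_induction_left with
    | one => exact Or.inl ⟨map_one _, map_one _⟩
    | mul_simple_left w i hw =>
      change (f (gen i * w) = 1 ∧ _) ∨ _
      change (_ ∧ coxeterMatrix353.toCoxeterSystem.lengthParity (gen i * w) = 1) ∨ (f (gen i * w) = _ ∧
        coxeterMatrix353.toCoxeterSystem.lengthParity (gen i * w) = _)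
      simp only [map_mul, lengthParity_gen, map_gen_eq_of_map_zero_eq_map_one h i]
      rcases hw with ⟨hw, hw'⟩ | ⟨hw, hw'⟩
      · exact Or.inr ⟨by rw [hw, mul_one], by rw [hw', mul_one]⟩
      · exact Or.inl ⟨by rw [hw, ← pow_two, hsq], by rw [hw']; rfl⟩
  ext w
  rw [MonoidHom.mem_ker, MonoidHom.mem_ker]
  rcases key w with ⟨hw, hw'⟩ | ⟨hw, hw'⟩
  · simp [hw, hw']
  · have : (Multiplicative.ofAdd 1 : C2) ≠ 1 := by decide
    simp [hw, hw', h1]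

theorem charP_eleven {F : Type} [Field F] (h : (11 : F) = 0) : CharP F 11 := by
  obtain ⟨p, hp⟩ := CharP.exists F
  have hdvd : p ∣ 11 := (CharP.cast_eq_zero_iff F p 11).1 (by exact_mod_cast h)
  rcases (Nat.dvd_prime (by norm_num)).1 hdvd with rfl | rfl
  · exact (CharP.false_of_nontrivial_of_char_one (R := F)).elim
  · exact hp

theorem ker_eq_ker_of_map_zero_ne_map_one {F L : Type} [Field F] [Field L]
    {f : GammaGroup →* L2 F} {f' : GammaGroup →* L2 L}
    (h : f (gen 0) ≠ f (gen 1)) (h' : f' (gen 0) ≠ f' (gen 1)) : f.ker = f'.ker := by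
  obtain ⟨hF, A, B, C, D, hA, hB, hC, hD, hAB, hC', hD'⟩ :=
    exists_lifts_of_coxeterRelations (coxeterRelations_map f) h
  obtain ⟨hL, A₁, B₁, C₁, D₁, hA₁, hB₁, hC₁, hD₁, hAB₁, hC₁', hD₁'⟩ :=
    exists_lifts_of_coxeterRelations (coxeterRelations_map f') h'
  have := charP_eleven hF
  have := charP_eleven hL
  refine ker_eq_of_sameCoeffsSubgroup_eq_top 11 (h := hAB) (h' := hAB₁) (by norm_num) ?_
  refine eq_top_of_gen_mem fun i ↦ ?_
  rw [mem_sameCoeffsSubgroup]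
  fin_cases i
  · exact ⟨![0, 1, 0, 0], ⟨A, hA, by simp [pairComb]⟩, A₁, hA₁, by simp [pairComb]⟩
  · exact ⟨![0, 0, 1, 0], ⟨B, hB, by simp [pairComb]⟩, B₁, hB₁, by simp [pairComb]⟩
  · exact ⟨_, ⟨C, hC, hC'⟩, C₁, hC₁, hC₁'⟩
  · exact ⟨_, ⟨D, hD, hD'⟩, D₁, hD₁, hD₁'⟩

end GammaGroup

/-! ### Rotations and kernels of homomorphisms from `Δ` to `L₂(11)` -/

section EvenSubgroup

/-- The rotation `gen i * gen j` in the even subgroup. -/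
def rot (i j : Fin 4) : evenSubgroup :=
  ⟨gen i * gen j, by
    rw [MonoidHom.mem_ker, map_mul, lengthParity_gen, lengthParity_gen]
    decide⟩

theorem coe_rot (i j : Fin 4) : (rot i j : GammaGroup) = gen i * gen j := rfl

theorem gen_mul_self (i : Fin 4) : gen i * gen i = 1 :=
  coxeterMatrix353.toCoxeterSystem.simple_mul_simple_self i

theorem rot_mul_rot (i j k : Fin 4) : rot i j * rot j k = rot i k := by
  apply Subtype.ext
  rw [Subgroup.coe_mul, coe_rot, coe_rot, coe_rot, mul_assoc, ← mul_assoc (gen j), gen_mul_self,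
    one_mul]

theorem rot_self (i : Fin 4) : rot i i = 1 := Subtype.ext (gen_mul_self i)

theorem eq_top_of_rot_mem {T : Subgroup evenSubgroup} (hx : rot 0 1 ∈ T) (hy : rot 1 2 ∈ T)
    (hz : rot 2 3 ∈ T) : T = ⊤ := by
  have h0 (i : Fin 4) : rot 0 i ∈ T := by
    fin_cases i
    · exact rot_self 0 ▸ T.one_mem
    · exact hx
    · exact rot_mul_rot 0 1 2 ▸ T.mul_mem hx hy
    · exact rot_mul_rot 0 2 3 ▸ T.mul_mem (rot_mul_rot 0 1 2 ▸ T.mul_mem hx hy) hz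
  have h0' (i : Fin 4) : rot i 0 ∈ T := by
    rw [eq_inv_of_mul_eq_one_left ((rot_mul_rot i 0 i).trans (rot_self i))]
    exact T.inv_mem (h0 i)
  -- `T` and its translate by `gen 0` cover `Γ`; parity then rules out the translate for even `w`.
  have key (w : GammaGroup) : w ∈ T.map evenSubgroup.subtype ∨
      gen 0 * w ∈ T.map evenSubgroup.subtype := by
    induction w using coxeterMatrix353.toCoxeterSystem.simple_induction_left with
    | one => exact Or.inl (one_mem _)
    | mul_simple_left w i hw =>
      change gen i * w ∈ _ ∨ gen 0 * (gen i * w) ∈ _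
      rcases hw with hw | hw
      · right
        rw [← mul_assoc]
        exact mul_mem (Subgroup.mem_map_of_mem _ (h0 i)) hw
      · left
        have : gen i * w = gen i * gen 0 * (gen 0 * w) := by
          rw [mul_assoc, ← mul_assoc (gen 0), gen_mul_self, one_mul]
        rw [this]
        exact mul_mem (Subgroup.mem_map_of_mem _ (h0' i)) hw
  rw [eq_top_iff]
  rintro ⟨w, hw⟩ -
  rcases key w with ⟨v, hv, hvw⟩ | ⟨v, hv, hvw⟩
  · rwa [show v = ⟨w, hw⟩ from Subtype.ext hvw] at hv
  · have h1 : gen 0 * w ∈ evenSubgroup := by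
      rw [← hvw]
      exact v.2
    rw [MonoidHom.mem_ker, map_mul, MonoidHom.mem_ker.1 hw, mul_one, lengthParity_gen] at h1
    exact absurd h1 (by decide)

theorem rotationRelations_map {G : Type*} [Group G] (σ : evenSubgroup →* G) :
    RotationRelations (σ (rot 0 1)) (σ (rot 1 2)) (σ (rot 2 3)) := by
  have h := (coxeterRelations_map (MonoidHom.id GammaGroup)).rotations
  have lift {n : ℕ} {g : evenSubgroup} (hg : (g : GammaGroup) ^ n = 1) : σ g ^ n = 1 := by
    rw [← map_pow, show g ^ n = 1 from Subtype.ext hg, map_one]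
  refine ⟨lift h.x_pow, lift h.y_pow, lift h.z_pow, ?_, ?_, ?_⟩ <;> simp only [← map_mul]
  exacts [lift h.xy_sq, lift h.yz_sq, lift h.xyz_sq]

theorem map_rot_ne_one {G : Type*} [Group G] {σ : evenSubgroup →* G} (hσ : σ.ker ≠ ⊤) :
    σ (rot 0 1) ≠ 1 := by
  intro hx
  have h := rotationRelations_map σ
  have hy : σ (rot 1 2) = 1 :=
    eq_one_of_pow_two_of_pow_five (by simpa [hx] using h.xy_sq) h.y_pow
  have hz : σ (rot 2 3) = 1 :=
    eq_one_of_pow_two_of_pow_three (by simpa [hy] using h.yz_sq) h.z_pow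
  exact hσ (eq_top_of_rot_mem hx hy hz)

theorem ker_eq_ker_of_ker_ne_top {σ τ : evenSubgroup →* L2 (ZMod 11)} (hσ : σ.ker ≠ ⊤)
    (hτ : τ.ker ≠ ⊤) : σ.ker = τ.ker := by
  obtain ⟨X, Y, W, hX, hY, hW, hXY, hW'⟩ :=
    exists_lifts_of_rotationRelations (rotationRelations_map σ) (map_rot_ne_one hσ)
  obtain ⟨X₁, Y₁, W₁, hX₁, hY₁, hW₁, hXY₁, hW₁'⟩ :=
    exists_lifts_of_rotationRelations (rotationRelations_map τ) (map_rot_ne_one hτ)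
  refine ker_eq_of_sameCoeffsSubgroup_eq_top 11 (h := hXY) (h' := hXY₁) (by norm_num) ?_
  have hy : rot 1 2 ∈ sameCoeffsSubgroup σ τ hXY hXY₁ := ⟨![0, 0, 1, 0],
    ⟨Y, hY, by simp [pairComb]⟩, Y₁, hY₁, by simp [pairComb]⟩
  have hw : rot 1 2 * rot 2 3 ∈ sameCoeffsSubgroup σ τ hXY hXY₁ :=
    ⟨_, ⟨W, by rw [hW, map_mul], hW'⟩, W₁, by rw [hW₁, map_mul], hW₁'⟩
  exact eq_top_of_rot_mem ⟨![0, 1, 0, 0], ⟨X, hX, by simp [pairComb]⟩, X₁, hX₁, by simp [pairComb]⟩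
    hy ((Subgroup.mul_mem_cancel_left _ hy).1 hw)

end EvenSubgroup

/-! ### An explicit representation in characteristic 11 -/

section Representation

/-- Matrices over the field of order `11` that satisfy the relations of `Γ` up to sign. -/
def genMatrix : Fin 4 → Matrix (Fin 2) (Fin 2) (ZMod 11) :=
  ![!![0, 1; 10, 0], !![1, 4; 5, 10], !![3, 1; 1, 8], !![7, 7; 7, 4]]

theorem det_genMatrix (i : Fin 4) : (genMatrix i).det = 1 := by
  revert i
  decide

theorem genMatrix_mul_pow (i j : Fin 4) : (genMatrix i * genMatrix j) ^ coxeterMatrix353 i j = 1 ∨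
    (genMatrix i * genMatrix j) ^ coxeterMatrix353 i j = -1 := by
  fin_cases i <;> fin_cases j <;> decide +kernel

/-- The matrices `genMatrix` as elements of `SL₂`. -/
def genSL (i : Fin 4) : Matrix.SpecialLinearGroup (Fin 2) (ZMod 11) :=
  ⟨genMatrix i, det_genMatrix i⟩

theorem coe_genSL (i : Fin 4) : (genSL i : Matrix (Fin 2) (Fin 2) (ZMod 11)) = genMatrix i := rfl

theorem genSL_mul_pow (i j : Fin 4) : (genSL i * genSL j) ^ coxeterMatrix353 i j = 1 ∨
    (genSL i * genSL j) ^ coxeterMatrix353 i j = -1 :=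
  (genMatrix_mul_pow i j).imp Subtype.ext Subtype.ext

/-- The homomorphism from `Γ` to `L₂(F)`, for a field `F` of characteristic `11`, given by the
matrices `genMatrix`. -/
def rep (F : Type) [Field F] [CharP F 11] : GammaGroup →* L2 F :=
  coxeterMatrix353.toCoxeterSystem.lift ⟨fun i ↦ toL2 F
    (Matrix.SpecialLinearGroup.map (ZMod.castHom (dvd_refl 11) F) (genSL i)), fun i j ↦ by
      rw [← map_mul, ← map_mul, ← map_pow, ← map_pow]
      rcases genSL_mul_pow i j with h | h
      · rw [h, map_one, map_one]
      · have hneg : Matrix.SpecialLinearGroup.map (ZMod.castHom (dvd_refl 11) F)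
            (-1 : Matrix.SpecialLinearGroup (Fin 2) (ZMod 11)) = -1 := by
          ext i j
          simp [one_apply, apply_ite]
        rw [h, hneg, toL2_neg, map_one]⟩

theorem rep_gen (F : Type) [Field F] [CharP F 11] (i : Fin 4) : rep F (gen i) =
    toL2 F (Matrix.SpecialLinearGroup.map (ZMod.castHom (dvd_refl 11) F) (genSL i)) :=
  CoxeterSystem.lift_apply_simple _ _ i

theorem rep_zmod_gen (i : Fin 4) : rep (ZMod 11) (gen i) = toL2 (ZMod 11) (genSL i) := by
  rw [rep_gen]
  congr 1
  ext
  simp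

theorem rep_gen_zero_ne (F : Type) [Field F] [CharP F 11] : rep F (gen 0) ≠ rep F (gen 1) := by
  rw [rep_gen, rep_gen, ne_eq, toL2_eq_iff, not_or]
  constructor <;>
  · intro h
    have := congrArg (fun M ↦ M.1 0 0) h
    simp [coe_genSL, genMatrix] at this

theorem rep_gen_zero_ne_one (F : Type) [Field F] [CharP F 11] : rep F (gen 0) ≠ 1 :=
  (coxeterRelations_map (rep F)).a_ne_one (rep_gen_zero_ne F)

end Representation

/-! ### Surjectivity onto `L₂(11)`, already from `Δ` -/

section Generation

variable {F : Type} [Field F]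

/-- The upper unitriangular matrices. -/
def upperUni (t : F) : Matrix.SpecialLinearGroup (Fin 2) F := ⟨!![1, t; 0, 1], by simp⟩

/-- The lower unitriangular matrices. -/
def lowerUni (t : F) : Matrix.SpecialLinearGroup (Fin 2) F := ⟨!![1, 0; t, 1], by simp⟩

theorem coe_upperUni (t : F) : (upperUni t : Matrix (Fin 2) (Fin 2) F) = !![1, t; 0, 1] := rfl

theorem coe_lowerUni (t : F) : (lowerUni t : Matrix (Fin 2) (Fin 2) F) = !![1, 0; t, 1] := rfl

theorem upperUni_pow (n : ℕ) : upperUni (1 : F) ^ n = upperUni (n : F) := by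
  apply Subtype.ext
  induction n with
  | zero => simp [coe_upperUni, one_fin_two]
  | succ n ih =>
    rw [Matrix.SpecialLinearGroup.coe_pow] at ih ⊢
    rw [pow_succ, ih]
    simp [coe_upperUni, add_comm]

theorem lowerUni_pow (n : ℕ) : lowerUni (1 : F) ^ n = lowerUni (n : F) := by
  apply Subtype.ext
  induction n with
  | zero => simp [coe_lowerUni, one_fin_two]
  | succ n ih =>
    rw [Matrix.SpecialLinearGroup.coe_pow] at ih ⊢
    rw [pow_succ, ih]
    simp [coe_lowerUni]

/-- Factorisation of the big Bruhat cell, showing that unipotents generate. -/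
theorem eq_upperUni_mul_lowerUni_mul_upperUni (M : Matrix.SpecialLinearGroup (Fin 2) F)
    (hc : M.1 1 0 ≠ 0) : M = upperUni ((M.1 0 0 - 1) / M.1 1 0) * lowerUni (M.1 1 0) *
      upperUni ((M.1 1 1 - 1) / M.1 1 0) := by
  have h := M.det_coe
  rw [det_fin_two] at h
  ext i j
  fin_cases i <;> fin_cases j <;>
    simp [coe_upperUni, coe_lowerUni, mul_apply, Fin.sum_univ_two] <;> field_simp <;>
    first | ring1 | linear_combination -h

theorem eq_top_of_unipotents_mem {p : ℕ} [Fact p.Prime]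
    {H : Subgroup (Matrix.SpecialLinearGroup (Fin 2) (ZMod p))}
    (hU : upperUni 1 ∈ H) (hL : lowerUni 1 ∈ H) : H = ⊤ := by
  have hU' (t : ZMod p) : upperUni t ∈ H := by
    rw [← ZMod.natCast_zmod_val t, ← upperUni_pow]
    exact pow_mem hU _
  have hL' (t : ZMod p) : lowerUni t ∈ H := by
    rw [← ZMod.natCast_zmod_val t, ← lowerUni_pow]
    exact pow_mem hL _
  have key (M : Matrix.SpecialLinearGroup (Fin 2) (ZMod p)) (hc : M.1 1 0 ≠ 0) : M ∈ H := by
    rw [eq_upperUni_mul_lowerUni_mul_upperUni M hc]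
    exact mul_mem (mul_mem (hU' _) (hL' _)) (hU' _)
  refine (Subgroup.eq_top_iff' _).2 fun M ↦ ?_
  by_cases hc : M.1 1 0 = 0
  -- Multiplying by `lowerUni 1` makes the lower left entry equal to the upper left one, which is
  -- nonzero.
  · refine (Subgroup.mul_mem_cancel_left _ hL).1 (key _ ?_)
    have h := M.det_coe
    rw [det_fin_two, hc, mul_zero, sub_zero] at h
    simpa [coe_lowerUni, mul_apply, Fin.sum_univ_two, hc] using left_ne_zero_of_mul_eq_one h
  · exact key M hc

theorem range_rep_comp_subtype : ((rep (ZMod 11)).comp evenSubgroup.subtype).range = ⊤ := by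
  have hrot (i j : Fin 4) : ((rep (ZMod 11)).comp evenSubgroup.subtype) (rot i j) =
      toL2 (ZMod 11) (genSL i * genSL j) := by
    rw [MonoidHom.comp_apply, Subgroup.coe_subtype, coe_rot, map_mul, map_mul, rep_zmod_gen,
      rep_zmod_gen]
  have hcomap : ((rep (ZMod 11)).comp evenSubgroup.subtype).range.comap (toL2 (ZMod 11)) = ⊤ := by
    apply eq_top_of_unipotents_mem
    -- A word in the rotations whose matrix is `upperUni 1` up to sign; the next word does this for
    -- `lowerUni 1`.
    · refine ⟨rot 1 2 * rot 3 2 * rot 1 0 * rot 2 3, ?_⟩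
      simp only [map_mul, hrot]
      simp only [← map_mul]
      rw [toL2_eq_iff]
      refine Or.imp Subtype.ext Subtype.ext ?_
      change _ = !![_, _; _, _] ∨ _ = -!![_, _; _, _]
      simp only [Matrix.SpecialLinearGroup.coe_mul, coe_genSL]
      decide +kernel
    · refine ⟨rot 2 3 * rot 2 1 * rot 2 1 * rot 0 3, ?_⟩
      simp only [map_mul, hrot]
      simp only [← map_mul]
      rw [toL2_eq_iff]
      refine Or.imp Subtype.ext Subtype.ext ?_
      change _ = !![_, _; _, _] ∨ _ = -!![_, _; _, _]
      simp only [Matrix.SpecialLinearGroup.coe_mul, coe_genSL]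
      decide +kernel
  rw [← Subgroup.map_comap_eq_self_of_surjective toL2_surjective
    ((rep (ZMod 11)).comp evenSubgroup.subtype).range, hcomap]
  exact Subgroup.map_top_of_surjective _ toL2_surjective

theorem rep_comp_subtype_surjective :
    Function.Surjective ((rep (ZMod 11)).comp evenSubgroup.subtype) :=
  MonoidHom.range_eq_top.1 range_rep_comp_subtype

theorem rep_surjective : Function.Surjective (rep (ZMod 11)) := fun x ↦
  let ⟨w, hw⟩ := rep_comp_subtype_surjective x
  ⟨w, hw⟩

end Generation

/-! ### Identification of the quotients, `K₀` and `N₀` -/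

section Quotients

/-- By simplicity the alternative is an abelian group, where the image of `ab` would have order
dividing both 2 and 3. -/
theorem center_L2_eleven : Subgroup.center (L2 (ZMod 11)) = ⊥ := by
  have : IsSimpleGroup (L2 (ZMod 11)) :=
    Matrix.ProjectiveSpecialLinearGroup.rank_two_simple (by simp)
  refine (Subgroup.center (L2 (ZMod 11))).normal_of_characteristic.eq_bot_or_eq_top.resolve_right
    fun h ↦ ?_
  have h0 := coxeterRelations_map (rep (ZMod 11))
  have hcomm : rep (ZMod 11) (gen 0) * rep (ZMod 11) (gen 1) =
      rep (ZMod 11) (gen 1) * rep (ZMod 11) (gen 0) :=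
    (Subgroup.mem_center_iff.1 (h ▸ Subgroup.mem_top (rep (ZMod 11) (gen 1))) _)
  refine h0.ab_ne_one (rep_gen_zero_ne _) (eq_one_of_pow_two_of_pow_three ?_ h0.ab)
  rw [(show Commute _ _ from hcomm).mul_pow, h0.a_sq, h0.b_sq, one_mul]

/-- The homomorphism `Γ → L₂(11) × C₂` given by `rep` and the parity. -/
def repProd : GammaGroup →* L2 (ZMod 11) × C2 :=
  (rep (ZMod 11)).prod coxeterMatrix353.toCoxeterSystem.lengthParity

theorem ker_map_subtype_eq_ker_repProd :
    ((rep (ZMod 11)).comp evenSubgroup.subtype).ker.map evenSubgroup.subtype = repProd.ker := by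
  ext w
  simp only [Subgroup.mem_map, MonoidHom.mem_ker, repProd, MonoidHom.prod_apply, Prod.mk_eq_one]
  constructor
  · rintro ⟨v, hv, rfl⟩
    exact ⟨hv, v.2⟩
  · rintro ⟨h, h'⟩
    exact ⟨⟨w, h'⟩, h, rfl⟩

theorem repProd_surjective : Function.Surjective repProd := by
  have hone (x : L2 (ZMod 11)) : ∃ w, repProd w = (x, 1) := by
    obtain ⟨w, hw⟩ := rep_comp_subtype_surjective x
    exact ⟨w, Prod.ext hw w.2⟩
  rintro ⟨x, y⟩
  have hy : y = 1 ∨ y = Multiplicative.ofAdd 1 := by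
    revert y
    decide
  rcases hy with rfl | rfl
  · exact hone x
  · obtain ⟨w, hw⟩ := hone (x * (rep (ZMod 11) (gen 0))⁻¹)
    refine ⟨w * gen 0, ?_⟩
    rw [map_mul, hw]
    exact Prod.ext (inv_mul_cancel_right _ _) ((one_mul _).trans (lengthParity_gen 0))

/-- As `L₂(11)` has trivial centre, the factor `C₂` is the centre of the product. The right side
does not mention `φ`. -/
theorem overgroupOfC2Factor_eq_comap_center (K : Subgroup GammaGroup) [K.Normal]
    (φ : GammaGroup ⧸ K ≃* L2 (ZMod 11) × C2) :
    overgroupOfC2Factor K φ = (Subgroup.center (GammaGroup ⧸ K)).comap (QuotientGroup.mk' K) := by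
  have hcenter (x : L2 (ZMod 11) × C2) :
      x ∈ Subgroup.center (L2 (ZMod 11) × C2) ↔ x.1 = 1 := by
    rw [← Subgroup.mem_bot, ← center_L2_eleven, Subgroup.mem_center_iff, Subgroup.mem_center_iff]
    refine ⟨fun h g ↦ congrArg Prod.fst (h (g, 1)), fun h g ↦ Prod.ext (h g.1) (mul_comm _ _)⟩
  ext w
  have h1 : w ∈ overgroupOfC2Factor K φ ↔ (φ w).1 = 1 := by
    simp [overgroupOfC2Factor, Subgroup.mem_prod]
  rw [h1, ← hcenter, Subgroup.mem_comap, QuotientGroup.mk'_apply, Subgroup.mem_center_iff,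
    Subgroup.mem_center_iff]
  constructor
  · intro h g
    apply φ.injective
    rw [map_mul, map_mul, h]
  · intro h g
    obtain ⟨g, rfl⟩ := φ.surjective g
    rw [← map_mul, ← map_mul, h]

theorem ker_rep_eq_overgroupOfC2Factor (φ : GammaGroup ⧸ repProd.ker ≃* L2 (ZMod 11) × C2) :
    (rep (ZMod 11)).ker = overgroupOfC2Factor repProd.ker φ := by
  -- Passing through the centre exchanges `φ` for the isomorphism induced by `repProd`.
  rw [overgroupOfC2Factor_eq_comap_center, ← overgroupOfC2Factor_eq_comap_center repProd.ker
    (QuotientGroup.quotientKerEquivOfSurjective repProd repProd_surjective)]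
  ext w
  simp only [overgroupOfC2Factor, Subgroup.mem_comap, Subgroup.mem_prod, Subgroup.mem_bot,
    Subgroup.mem_top, and_true]
  rfl

theorem hasQuotientL2Eleven_iff (K : Subgroup evenSubgroup) :
    HasQuotientL2Eleven K ↔ K = ((rep (ZMod 11)).comp evenSubgroup.subtype).ker := by
  have hnontrivial : Nontrivial (L2 (ZMod 11)) :=
    ⟨_, _, rep_gen_zero_ne_one (ZMod 11)⟩
  have ker_ne_top {σ : evenSubgroup →* L2 (ZMod 11)} (h : Function.Surjective σ) : σ.ker ≠ ⊤ := by
    intro htop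
    obtain ⟨x, hx⟩ := exists_ne (1 : L2 (ZMod 11))
    obtain ⟨w, rfl⟩ := h x
    exact hx (MonoidHom.mem_ker.1 (htop ▸ Subgroup.mem_top w))
  constructor
  · rintro ⟨hK, ⟨φ⟩⟩
    have hker : (φ.toMonoidHom.comp (QuotientGroup.mk' K)).ker = K := by
      ext w
      simp
    rw [← hker]
    exact ker_eq_ker_of_ker_ne_top
      (ker_ne_top (φ.surjective.comp (QuotientGroup.mk'_surjective K)))
      (ker_ne_top rep_comp_subtype_surjective)
  · rintro rfl
    exact ⟨inferInstance, ⟨QuotientGroup.quotientKerEquivOfSurjective _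
      rep_comp_subtype_surjective⟩⟩

theorem isoToSubgroupOfSomeL2_quotient_ker {p n : ℕ} [Fact p.Prime] (hn : n ≠ 0)
    (f : GammaGroup →* L2 (GaloisField p n)) : IsoToSubgroupOfSomeL2 (GammaGroup ⧸ f.ker) :=
  ⟨p, n, inferInstance, hn, f.range, ⟨QuotientGroup.quotientKerEquivRange f⟩⟩

theorem isoToSubgroupOfSomeL2_quotient_iff (N : Subgroup GammaGroup) :
    (∃ _ : N.Normal, N ≠ ⊤ ∧ IsoToSubgroupOfSomeL2 (GammaGroup ⧸ N)) ↔
      N = evenSubgroup ∨ N = (rep (ZMod 11)).ker := by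
  constructor
  · rintro ⟨hN, htop, p, n, hp, -, H, ⟨e⟩⟩
    have hker : (H.subtype.comp (e.toMonoidHom.comp (QuotientGroup.mk' N))).ker = N := by
      ext w
      simp
    generalize H.subtype.comp (e.toMonoidHom.comp (QuotientGroup.mk' N)) = f at hker
    subst hker
    by_cases h : f (gen 0) = f (gen 1)
    · refine Or.inl (ker_eq_evenSubgroup h fun h1 ↦ htop (eq_top_of_gen_mem fun i ↦ ?_))
      rw [MonoidHom.mem_ker, map_gen_eq_of_map_zero_eq_map_one h, h1]
    · exact Or.inr (ker_eq_ker_of_map_zero_ne_map_one h (rep_gen_zero_ne _))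
  · have : CharP (GaloisField 11 1) 11 := inferInstance
    have ker_ne_top {f : GammaGroup →* L2 (GaloisField 11 1)} (h : f (gen 0) ≠ 1) :
        f.ker ≠ ⊤ := fun htop ↦ h (MonoidHom.mem_ker.1 (htop ▸ Subgroup.mem_top (gen 0)))
    rintro (rfl | rfl)
    -- `Δ` is the kernel of the map sending every generator to one fixed involution.
    · have hlift : coxeterMatrix353.IsLiftable
          (fun _ ↦ rep (GaloisField 11 1) (gen 0)) := fun i j ↦ by
        rw [← pow_two, (coxeterRelations_map _).a_sq, one_pow]
      have hgen (i : Fin 4) : coxeterMatrix353.toCoxeterSystem.lift ⟨_, hlift⟩ (gen i) =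
        rep (GaloisField 11 1) (gen 0) := CoxeterSystem.lift_apply_simple _ hlift i
      have h1 : coxeterMatrix353.toCoxeterSystem.lift ⟨_, hlift⟩ (gen 0) ≠ 1 := by
        rw [hgen]
        exact rep_gen_zero_ne_one _
      rw [← ker_eq_evenSubgroup (by rw [hgen, hgen]) h1]
      exact ⟨inferInstance, ker_ne_top h1, isoToSubgroupOfSomeL2_quotient_ker one_ne_zero _⟩
    -- Uniqueness of the kernel transfers the representation from `ZMod 11` to `GaloisField 11 1`
    -- without identifying the fields.
    · rw [ker_eq_ker_of_map_zero_ne_map_one (rep_gen_zero_ne (ZMod 11))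
        (rep_gen_zero_ne (GaloisField 11 1))]
      exact ⟨inferInstance, ker_ne_top (rep_gen_zero_ne_one _),
        isoToSubgroupOfSomeL2_quotient_ker one_ne_zero _⟩

theorem lengthParity_surjective :
    Function.Surjective coxeterMatrix353.toCoxeterSystem.lengthParity := fun y ↦
  let ⟨w, hw⟩ := repProd_surjective (1, y)
  ⟨w, congrArg Prod.snd hw⟩

end Quotients

theorem corollary1p5 :
    ∃ K₀ : Subgroup evenSubgroup,
      (∀ K : Subgroup evenSubgroup, HasQuotientL2Eleven K ↔ K = K₀) ∧
      ∃ _ : (K₀.map evenSubgroup.subtype).Normal,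
        Nonempty (GammaGroup ⧸ K₀.map evenSubgroup.subtype ≃* L2 (ZMod 11) × C2) ∧
        ∃ N₀ : Subgroup GammaGroup,
          (∀ φ : GammaGroup ⧸ K₀.map evenSubgroup.subtype ≃* L2 (ZMod 11) × C2,
            N₀ = overgroupOfC2Factor (K₀.map evenSubgroup.subtype) φ) ∧
          (∀ N : Subgroup GammaGroup,
            (∃ _ : N.Normal, N ≠ ⊤ ∧ IsoToSubgroupOfSomeL2 (GammaGroup ⧸ N)) ↔
              N = evenSubgroup ∨ N = N₀) ∧
          Nonempty (GammaGroup ⧸ evenSubgroup ≃* C2) ∧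
          ∃ _ : N₀.Normal, Nonempty (GammaGroup ⧸ N₀ ≃* L2 (ZMod 11)) := by
  refine ⟨_, hasQuotientL2Eleven_iff, ?_⟩
  rw [ker_map_subtype_eq_ker_repProd]
  exact ⟨inferInstance, ⟨QuotientGroup.quotientKerEquivOfSurjective _ repProd_surjective⟩,
    (rep (ZMod 11)).ker, ker_rep_eq_overgroupOfC2Factor, isoToSubgroupOfSomeL2_quotient_iff,
    ⟨QuotientGroup.quotientKerEquivOfSurjective _ lengthParity_surjective⟩, inferInstance,
    ⟨QuotientGroup.quotientKerEquivOfSurjective _ rep_surjective⟩⟩
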